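/- Let $\mathbf T$ be one of the homogeneous tournaments $I_1$ (one point), $C_3$ (the directed $3$-cycle), $\mathbb Q$ (with $E(x,y)$ iff $x<y$), $\mathbf S(2)$ (the points at rational angle on the unit circle, with $E(x,y)$ iff the angle from $x$ to $y$ lies in $(0,\pi)$), $T^\omega$ (the generic countable tournament), and let $\mathbf T^*$ be the following expansion of $\mathbf T$, which carries a distinguished linear ordering $<^*$: - $I_1^*$ adds a unary predicate naming the point (with the trivial ordering); - $C_3^*$ adds three unary predicates, one naming each point, and any linear ordering of the three points; - $\mathbb Q^*=\mathbb Q$, where $<^*$ is the usual ordering; - $\mathbf S(2)^*$ adds two unary predicates for the left and the right half of the circle, and the linear ordering obtained from $E$ by reversing the edges between points in different halves; - $T^{\omega *}$ adds a generic linear ordering, i.e. it is the Fraïssé limit of the class of all finite linearly ordered tournaments. For an integer $n\ge 1$ let $\mathbf T[I_n]^*$ be the structure with universe $T\times\{0,\dots,n-1\}$ such that: $((x,i),(y,j))$ is an edge iff $(x,y)$ is an edge of $\mathbf T$; every relation symbol $R$ of $\mathbf T^*$ other than $E,<$ holds at a tuple iff it holds in $\mathbf T^*$ at the tuple of first coordinates;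 $<$ is the lexicographic ordering of $<^*$ and the usual ordering of $\{0,\dots,n-1\}$; and there are $n$ new unary predicates $L_0,\dots,L_{n-1}$ with $L_i(x,j)$ iff $j=i$. Let $\hat{\mathbf T}^*$ be the structure that is identical to $\mathbf T[I_2]^*$, except that for $i\ne j$ the pair $((y,i),(x,j))$ is an edge iff $(x,y)$ is an edge of $\mathbf T$. For a structure $\mathbf F$ let $\mathrm{Age}(\mathbf F)$ be the class of finite structures that embed in $\mathbf F$. A class $\mathcal K$ of finite structures has the Ramsey property if for all $k\in\mathbb N$ and all $\mathbf A,\mathbf B\in\mathcal K$ there is $\mathbf C\in\mathcal K$ such that for every colouring of the substructures of $\mathbf C$ isomorphic to $\mathbf A$ with $k$ colours there is a substructure $\mathbf B'\cong\mathbf B$ of $\mathbf C$ such that all the substructures of $\mathbf B'$ isomorphic to $\mathbf A$ have the same colour. Theorem. For every $n\ge 1$ the class $\mathrm{Age}(\mathbf T[I_n]^*)$ has the Ramsey property, and so does the class $\mathrm{Age}(\hat{\mathbf T}^*)$. -/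

import Mathlib

universe u v

open CategoryTheory
open scoped FirstOrder

/-! ### The Ramsey property for classes of finite structures -/

section Ramsey

variable (L : FirstOrder.Language.{0, 0})

/-- The set `binom(B, A)` of copies of `A` in `B`: substructures of `B` isomorphic to `A`. -/
def Copies (A : Type u) (B : Type u) [L.Structure A] [L.Structure B] :
    Set (L.Substructure B) :=
  {A' | Nonempty (A' ≃[L] A)}

/-- The arrow relation `C → (B)^A_k`: for every colouring of the copies of `A` in `C` with `k`
colours there is a copy `B'` of `B` in `C` such that the copies of `A` that lie in `B'` receive at
most one colour. -/
def Arrow (C B A : Type u) [L.Structure C] [L.Structure B] [L.Structure A] (k : ℕ) : Prop :=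
  ∀ c : Copies L A C → Fin k, ∃ B' ∈ Copies L B C,
    ∀ A₁ A₂ : Copies L A C, A₁.1 ≤ B' → A₂.1 ≤ B' → c A₁ = c A₂

/-- The Ramsey property of a class of structures. -/
def HasRamseyProperty (K : Set (Bundled.{u} L.Structure)) : Prop :=
  ∀ k : ℕ, ∀ A ∈ K, ∀ B ∈ K, ∃ C ∈ K, Arrow L C B A k

end Ramsey

/-! ### Ordered directed graphs with unary predicates -/

/-- The relation symbols of the languages of the expansions: an edge symbol `E`, an order
symbol `<` and unary predicates indexed by `ι`. -/
inductive ExpRel (ι : Type) : ℕ → Type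
  | edge : ExpRel ι 2
  | lt : ExpRel ι 2
  | pred (i : ι) : ExpRel ι 1

/-- The relational language with binary symbols `E`, `<` and unary symbols indexed by `ι`. -/
def expLang (ι : Type) : FirstOrder.Language.{0, 0} := ⟨fun _ => Empty, ExpRel ι⟩

/-- An interpretation on `V` of the symbols `E`, `<` and of the unary predicates. -/
structure Expansion (ι : Type) (V : Type u) where
  edge : V → V → Prop
  lt : V → V → Prop
  pred : ι → V → Prop

namespace Expansion

variable {ι κ : Type} {V : Type u} {W : Type v}

/-- The first-order structure given by an interpretation. -/
@[reducible] def toStructure (X : Expansion ι V) : (expLang ι).Structure V where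
  funMap := fun f => Empty.elim f
  RelMap := fun r => match r with
    | .edge => fun v => X.edge (v 0) (v 1)
    | .lt => fun v => X.lt (v 0) (v 1)
    | .pred i => fun v => X.pred i (v 0)

/-- The age of the structure. -/
def age (X : Expansion ι V) : Set (Bundled.{u} (expLang ι).Structure) :=
  letI := X.toStructure
  (expLang ι).age V

/-- Isomorphism of structures. -/
def Iso (X : Expansion ι V) (Y : Expansion ι W) : Prop :=
  ∃ e : V ≃ W, (∀ x y, X.edge x y ↔ Y.edge (e x) (e y)) ∧
    (∀ x y, X.lt x y ↔ Y.lt (e x) (e y)) ∧ ∀ i x, X.pred i x ↔ Y.pred i (e x)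

/-- The structure `T[I_n]*`, for `X = T*`. Its vertices are the pairs `(x, i)` with `x ∈ T` and
`i < n`; edges and the old predicates are those of the first coordinates, the order is
lexicographic, and the new predicate `L_i` holds at `(x, j)` iff `j = i`. -/
def blowUp (X : Expansion ι V) (n : ℕ) : Expansion (ι ⊕ Fin n) (V × Fin n) where
  edge u v := X.edge u.1 v.1
  lt u v := X.lt u.1 v.1 ∨ (u.1 = v.1 ∧ u.2 < v.2)
  pred s u := match s with
    | .inl r => X.pred r u.1
    | .inr i => u.2 = i

/-- The structure `T̂*`, for `X = T*`: it is `T[I_2]*`, except that the edges between vertices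
with distinct second coordinates are reversed. -/
def hat (X : Expansion ι V) : Expansion (ι ⊕ Fin 2) (V × Fin 2) :=
  { X.blowUp 2 with
    edge := fun u v => (u.2 = v.2 ∧ X.edge u.1 v.1) ∨ (u.2 ≠ v.2 ∧ X.edge v.1 u.1) }

end Expansion

/-! ### The homogeneous tournaments and their expansions -/

/-- `E` is the edge relation of a tournament: it is asymmetric (hence irreflexive) and any two
distinct vertices are joined by an edge. -/
def IsTournament {V : Type u} (E : V → V → Prop) : Prop :=
  (∀ x y, E x y → ¬ E y x) ∧ ∀ x y, x ≠ y → E x y ∨ E y x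

/-- The one-point tournament `I_1` with its expansion `I_1*`: a unary predicate naming the point
(and the empty strict order). -/
def pointStar : Expansion (Fin 1) (Fin 1) where
  edge _ _ := False
  lt _ _ := False
  pred i x := x = i

/-- The cyclic tournament `C_3` with its expansion `C_3*`: three unary predicates naming the
points, and a linear order `lt`. -/
def cycleStar (lt : Fin 3 → Fin 3 → Prop) : Expansion (Fin 3) (Fin 3) where
  edge x y := y = x + 1
  lt := lt
  pred i x := x = i

/-- The rationals as a tournament, `E(x, y)` iff `x < y`, with `ℚ* = ℚ`: the order is the usual
one and no predicate is added. -/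
def ratStar : Expansion (Fin 0) ℚ where
  edge x y := x < y
  lt x y := x < y
  pred i _ := i.elim0

/-- The points of the unit circle that lie at a rational angle (in radians; so no two of these
points are antipodal, and none of them is at angle `π / 2` or `3 π / 2`). -/
def RatCircle : Type := {z : Circle // ∃ q : ℚ, z = Circle.exp (q : ℝ)}

/-- The angle from `x` to `y` is in `(0, π)`. -/
def RatCircle.edge (x y : RatCircle) : Prop :=
  Complex.arg ((y.1 / x.1 : Circle) : ℂ) ∈ Set.Ioo 0 Real.pi

/-- The point lies in the left half of the circle. -/
def RatCircle.isLeft (x : RatCircle) : Prop := (x.1 : ℂ).re < 0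

/-- The dense local order `S(2)` with its expansion `S(2)*`: two unary predicates for the left and
the right half of the circle, and the linear order that is obtained from the edge relation by
reversing the edges between points in different halves. -/
def localOrderStar : Expansion (Fin 2) RatCircle where
  edge := RatCircle.edge
  lt x y := ((x.isLeft ↔ y.isLeft) ∧ x.edge y) ∨ (¬ (x.isLeft ↔ y.isLeft) ∧ y.edge x)
  pred i x := if i = 0 then x.isLeft else ¬ x.isLeft

instance (ι : Type) (l : ℕ) : IsEmpty ((expLang ι).Functions l) :=
  inferInstanceAs (IsEmpty Empty)

/-- The class of finite linearly ordered tournaments. -/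
def orderedTournaments : Set (Bundled.{u} (expLang (Fin 0)).Structure) :=
  {M | Finite M ∧
    IsTournament (fun x y : M =>
      FirstOrder.Language.Structure.RelMap (L := expLang (Fin 0)) ExpRel.edge ![x, y]) ∧
    IsStrictTotalOrder M (fun x y : M =>
      FirstOrder.Language.Structure.RelMap (L := expLang (Fin 0)) ExpRel.lt ![x, y])}

/-- `X` is the generic tournament `T^ω` equipped with a generic linear order, that is, `X` is the
Fraïssé limit of the class of finite linearly ordered tournaments. -/
def IsGenericStar {V : Type u} (X : Expansion (Fin 0) V) : Prop :=
  ∃ _ : Countable V,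
    letI := X.toStructure
    FirstOrder.Language.IsFraisseLimit (L := expLang (Fin 0)) orderedTournaments V

/-- The list of the homogeneous tournaments: `I_1`, `C_3`, `ℚ`, `S(2)`, `T^ω`. -/
inductive HomTournament
  | point
  | cycle
  | rat
  | localOrder
  | generic

/-- The index set of the unary predicates that are added to a homogeneous tournament. -/
def HomTournament.Pred : HomTournament → Type
  | point => Fin 1
  | cycle => Fin 3
  | rat => Fin 0
  | localOrder => Fin 2
  | generic => Fin 0

/-- `X` is (up to isomorphism) the expansion `T*` of the homogeneous tournament `T`. -/
def HomTournament.IsStar {V : Type u} : (T : HomTournament) → Expansion T.Pred V → Prop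
  | point, X => X.Iso pointStar
  | cycle, X => ∃ lt : Fin 3 → Fin 3 → Prop, IsStrictTotalOrder (Fin 3) lt ∧ X.Iso (cycleStar lt)
  | rat, X => X.Iso ratStar
  | localOrder, X => X.Iso localOrderStar
  | generic, X => IsGenericStar X

/-! The age of `T*` has the Ramsey property even for colourings of finite families of vertices,
possibly with repetitions (`EmbRamsey`), and this form passes to the blow-ups. In `T[I_n]*` and
`T̂*` the predicates `L_i` name the second coordinates, so the type of a family is the type of its
first coordinates together with the sequence of second coordinates (`sameType_twist`). A colouring
of copies upstairs, with the second coordinates frozen, is a colouring of families in `T*`. Distinct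
vertices may share a first coordinate, hence the repetitions.

For `T*` itself, `I_1*` and `C_3*` are trivial because every point is named. The other three are
linear orders in which points and increasing pairs carry finitely many codes, and every finite
pattern of codes occurs. For such structures (`EmbRamsey.of_code`) the claim is the Nešetřil–Rödl
theorem for ordered binary structures, `exists_ordered_ramsey`. It is proved by the partite
construction: Hales–Jewett handles the copies of `A` over one fixed choice of parts, free
amalgamation treats all choices in turn, and the finite Ramsey theorem makes the colour independent
of the choice. -/

/-! ### The finite Ramsey theorem -/

/-- The finite Ramsey theorem, for sets of size `a`. -/
theorem exists_mono_finset {β : Type*} [LinearOrder β] (κ : Type*) [Finite κ] (a : ℕ) :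
    ∀ b : ℕ, ∃ p : ℕ, ∀ (c : Finset β → κ) (S : Finset β), p ≤ S.card →
      ∃ T ⊆ S, T.card = b ∧
        ∀ A₁ ⊆ T, ∀ A₂ ⊆ T, A₁.card = a → A₂.card = a → c A₁ = c A₂ := by
  classical
  induction a with
  | zero =>
    intro b
    refine ⟨b, fun c S hS => ?_⟩
    obtain ⟨T, hT, hb⟩ := Finset.exists_subset_card_eq hS
    refine ⟨T, hT, hb, fun A₁ _ A₂ _ h₁ h₂ => ?_⟩
    rw [Finset.card_eq_zero.1 h₁, Finset.card_eq_zero.1 h₂]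
  | succ a ih =>
    -- Large sets contain an `m`-set on which the colour of an `(a + 1)`-set depends only on its
    -- minimum.
    have key : ∀ m : ℕ, ∃ p : ℕ, ∀ (c : Finset β → κ) (S : Finset β), p ≤ S.card →
        ∃ T ⊆ S, T.card = m ∧ ∃ d : β → κ, ∀ x ∈ T, ∀ A ⊆ T, (∀ y ∈ A, x < y) →
          A.card = a → c (insert x A) = d x := by
      intro m
      induction m with
      | zero =>
        refine ⟨1, fun c S hS => ⟨∅, by simp, rfl, fun x => c {x}, by simp⟩⟩
      | succ m ihm =>
        obtain ⟨q, hq⟩ := ihm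
        -- Size `q` feeds the recursion; size `a` provides the set `A₀` whose colour becomes the
        -- value of `d` at the new minimum.
        obtain ⟨p, hp⟩ := ih (max q a)
        refine ⟨p + 1, fun c S hS => ?_⟩
        have hne : S.Nonempty := Finset.card_pos.1 (by omega)
        obtain ⟨S', hS', hcard, hmono⟩ := hp (fun A => c (insert (S.min' hne) A))
          (S.erase (S.min' hne)) (by rw [Finset.card_erase_of_mem (S.min'_mem hne)]; omega)
        obtain ⟨T, hT, hm, d, hd⟩ := hq c S' (by omega)
        obtain ⟨A₀, hA₀, hA₀c⟩ := Finset.exists_subset_card_eq (s := S') (n := a) (by omega)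
        have hlt : ∀ y ∈ T, S.min' hne < y := fun y hy =>
          Finset.min'_lt_of_mem_erase_min' _ hne (hS' (hT hy))
        refine ⟨insert (S.min' hne) T, ?_, ?_,
          fun x => if x = S.min' hne then c (insert (S.min' hne) A₀) else d x, ?_⟩
        · exact Finset.insert_subset (S.min'_mem hne)
            ((hT.trans hS').trans (Finset.erase_subset _ _))
        · rw [Finset.card_insert_of_notMem (fun h => (hlt _ h).false), hm]
        · intro x hx A hA hxA hAc
          have hAT : A ⊆ T := fun y hy => by
            rcases Finset.mem_insert.1 (hA hy) with h | h
            · rcases Finset.mem_insert.1 hx with h' | h'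
              · exact absurd (hxA y hy) (by rw [h, h']; exact lt_irrefl _)
              · exact absurd (hxA y hy) (by rw [h]; exact (hlt x h').not_gt)
            · exact h
          rcases Finset.mem_insert.1 hx with h | h
          · simp only [if_pos h]
            rw [h]
            exact hmono A (hAT.trans hT) A₀ hA₀ hAc hA₀c
          · simp only [if_neg (hlt x h).ne']
            exact hd x h A hAT hxA hAc
    intro b
    have := Fintype.ofFinite κ
    obtain ⟨p, hp⟩ := key (Fintype.card κ * b + 1)
    refine ⟨p, fun c S hS => ?_⟩
    obtain ⟨T, hT, hTc, d, hd⟩ := hp c S hS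
    obtain ⟨k, -, hk⟩ := Finset.exists_lt_card_fiber_of_mul_lt_card_of_maps_to
      (s := T) (t := Finset.univ) (f := d) (n := b) (by simp) (by simp [hTc])
    obtain ⟨U, hU, hUb⟩ := Finset.exists_subset_card_eq hk.le
    have hmin : ∀ A ⊆ U, A.card = a + 1 → c A = k := by
      intro A hA hAc
      have hne : A.Nonempty := Finset.card_pos.1 (by omega)
      have hUT : U ⊆ T := hU.trans (Finset.filter_subset _ _)
      have hmem := hA (A.min'_mem hne)
      rw [← Finset.insert_erase (A.min'_mem hne), hd _ (hUT hmem) (A.erase (A.min' hne))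
        ((Finset.erase_subset _ _).trans (hA.trans hUT))
        (fun y hy => Finset.min'_lt_of_mem_erase_min' _ hne hy)
        (by rw [Finset.card_erase_of_mem (A.min'_mem hne)]; omega)]
      exact (Finset.mem_filter.1 (hU hmem)).2
    exact ⟨U, (hU.trans (Finset.filter_subset _ _)).trans hT, hUb,
      fun A₁ h₁ A₂ h₂ e₁ e₂ => (hmin A₁ h₁ e₁).trans (hmin A₂ h₂ e₂).symm⟩

/-- The finite Ramsey theorem, for increasing sequences. -/
theorem exists_mono_strictMono (κ : Type*) [Finite κ] (a b : ℕ) :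
    ∃ p : ℕ, ∀ χ : (Fin a → Fin p) → κ, ∃ d : Fin b → Fin p, StrictMono d ∧
      ∀ g g' : Fin a → Fin b, StrictMono g → StrictMono g' → χ (d ∘ g) = χ (d ∘ g') := by
  classical
  obtain ⟨p, hp⟩ := exists_mono_finset (β := ℕ) (Option κ) a b
  refine ⟨p, fun χ => ?_⟩
  -- The ground set is `ℕ` because `p` is not known in advance; `none` is a default colour, as `κ`
  -- may be empty.
  let c : Finset ℕ → Option κ := fun A =>
    if h : ∃ t : Fin a → Fin p, StrictMono t ∧ Finset.univ.image (fun i => (t i : ℕ)) = A then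
      some (χ h.choose) else none
  have hc : ∀ t : Fin a → Fin p, StrictMono t →
      c (Finset.univ.image (fun i => (t i : ℕ))) = some (χ t) := by
    intro t ht
    have h : ∃ t' : Fin a → Fin p, StrictMono t' ∧ Finset.univ.image (fun i => (t' i : ℕ)) =
      Finset.univ.image (fun i => (t i : ℕ)) := ⟨t, ht, rfl⟩
    simp only [c, dif_pos h]
    congr 2
    have h1 := h.choose_spec
    have hr : Set.range (fun i => (h.choose i : ℕ)) = Set.range (fun i => (t i : ℕ)) := by
      have := congrArg (fun s : Finset ℕ => (s : Set ℕ)) h1.2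
      simpa using this
    have := (StrictMono.range_inj (f := fun i => (h.choose i : ℕ)) (g := fun i => (t i : ℕ))
      (fun i j hij => h1.1 hij) (fun i j hij => ht hij)).1 hr
    funext i
    exact Fin.ext (congrFun this i)
  obtain ⟨T, hT, hTb, hmono⟩ := hp c (Finset.range p) (by simp)
  have hlt : ∀ i, T.orderEmbOfFin hTb i < p := fun i =>
    Finset.mem_range.1 (hT (Finset.orderEmbOfFin_mem T hTb i))
  let d : Fin b → Fin p := fun i => ⟨T.orderEmbOfFin hTb i, hlt i⟩
  have hd : StrictMono d := fun i j hij => (T.orderEmbOfFin hTb).strictMono hij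
  have hsub : ∀ g : Fin a → Fin b, Finset.univ.image (fun i => ((d ∘ g) i : ℕ)) ⊆ T := by
    intro g x hx
    obtain ⟨i, -, rfl⟩ := Finset.mem_image.1 hx
    exact Finset.orderEmbOfFin_mem T hTb (g i)
  have hcard : ∀ g : Fin a → Fin b, StrictMono g →
      (Finset.univ.image (fun i => ((d ∘ g) i : ℕ))).card = a := by
    intro g hg
    refine (Finset.card_image_of_injective _
      (Fin.val_injective.comp (hd.comp hg).injective)).trans ?_
    simp
  refine ⟨d, hd, fun g g' hg hg' => Option.some_injective _ ?_⟩
  rw [← hc _ (hd.comp hg), ← hc _ (hd.comp hg')]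
  exact hmono _ (hsub g) _ (hsub g') (hcard g hg) (hcard g' hg')

/-! ### The partite construction -/

/-- A finite structure with binary relations coded by a colouring of the pairs of vertices by `Γ`,
whose vertices are distributed over parts indexed by `P`. -/
structure PartiteSystem (P Γ : Type*) where
  V : Type
  finite : Finite V
  part : V → P
  color : V → V → Γ

namespace PartiteSystem

variable {P Γ : Type*} {α : Type}

/-- Embeddings of partite systems. -/
def IsEmb (S T : PartiteSystem P Γ) (h : S.V → T.V) : Prop :=
  Function.Injective h ∧ (∀ v, T.part (h v) = S.part v) ∧
    ∀ v w, T.color (h v) (h w) = S.color v w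

theorem IsEmb.comp {S T U : PartiteSystem P Γ} {h : S.V → T.V} {h' : T.V → U.V}
    (hh' : IsEmb T U h') (hh : IsEmb S T h) : IsEmb S U (h' ∘ h) :=
  ⟨hh'.1.comp hh.1, fun v => (hh'.2.1 _).trans (hh.2.1 v),
    fun v w => (hh'.2.2 _ _).trans (hh.2.2 v w)⟩

/-- The copies of the structure `A` in `S` whose vertices lie in the parts given by `e`. -/
def IsSection (S : PartiteSystem P Γ) (A : α → α → Γ) (e : α → P) (s : α → S.V) : Prop :=
  (∀ i, S.part (s i) = e i) ∧ ∀ i j, S.color (s i) (s j) = A i j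

theorem IsSection.comp {S T : PartiteSystem P Γ} {A : α → α → Γ} {e : α → P} {s : α → S.V}
    {h : S.V → T.V} (hh : IsEmb S T h) (hs : S.IsSection A e s) : T.IsSection A e (h ∘ s) :=
  ⟨fun i => (hh.2.1 _).trans (hs.1 i), fun i j => (hh.2.2 _ _).trans (hs.2 i j)⟩

/-- The partite lemma. -/
theorem exists_partite_ramsey (κ : Type*) [Finite κ] [Finite α] (A : α → α → Γ)
    (E : PartiteSystem α Γ) : ∃ E' : PartiteSystem α Γ, ∀ χ : (α → E'.V) → κ,
      ∃ h, IsEmb E E' h ∧ ∀ s s', E.IsSection A id s → E.IsSection A id s' →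
        χ (h ∘ s) = χ (h ∘ s') := by
  classical
  have := E.finite
  obtain ⟨ι, _, hι⟩ := Combinatorics.Line.exists_mono_in_high_dimension
    {s : α → E.V // E.IsSection A id s} κ
  -- The alphabet for Hales–Jewett is the set of copies of `A` in `E`; a word is read coordinatewise
  -- as a copy of `A` in the power `E'`. The colour of a pair is taken from some coordinate that
  -- deviates from `A`, if there is one.
  let E' : PartiteSystem α Γ :=
    { V := {p : α × (ι → E.V) // ∀ n, E.part (p.2 n) = p.1}
      finite := inferInstance
      part := fun p => p.1.1
      color := fun p q => if h : ∃ n, E.color (p.1.2 n) (q.1.2 n) ≠ A p.1.1 q.1.1 then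
        E.color (p.1.2 h.choose) (q.1.2 h.choose) else A p.1.1 q.1.1 }
  refine ⟨E', fun χ => ?_⟩
  obtain ⟨l, k, hl⟩ := hι fun φ => χ fun i => ⟨(i, fun n => (φ n).1 i), fun n => (φ n).2.1 i⟩
  obtain ⟨n₀, hn₀⟩ := l.proper
  -- The line embeds `E`: `v` stands at the active coordinates, and at a constant coordinate the
  -- vertex of the fixed copy in the part of `v`.
  let w : E.V → ι → E.V := fun v n => (l.idxFun n).elim v fun s => s.1 (E.part v)
  have hw : ∀ v n, E.part (w v n) = E.part v := by
    intro v n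
    cases h : l.idxFun n with
    | none => simp [w, h]
    | some s => simpa [w, h] using s.2.1 (E.part v)
  have hw₀ : ∀ v, w v n₀ = v := fun v => by simp [w, hn₀]
  -- Constant coordinates agree with `A`, so every deviating coordinate is active and shows the true
  -- colour of the pair.
  have hwc : ∀ u v n, E.color (w u n) (w v n) ≠ A (E.part u) (E.part v) →
      E.color (w u n) (w v n) = E.color u v := by
    intro u v n hne
    cases h : l.idxFun n with
    | none => simp [w, h]
    | some s => exact absurd (by simpa [w, h] using s.2.2 (E.part u) (E.part v)) hne
  refine ⟨fun v => ⟨(E.part v, w v), hw v⟩, ⟨fun u v huv => ?_, fun _ => rfl, fun u v => ?_⟩,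
    fun s s' hs hs' => ?_⟩
  · have := congrArg (fun p : E'.V => p.1.2 n₀) huv
    simpa [hw₀] using this
  · by_cases h : ∃ n, E.color (w u n) (w v n) ≠ A (E.part u) (E.part v)
    · exact (dif_pos h).trans (hwc u v _ h.choose_spec)
    · refine (dif_neg h).trans ?_
      push Not at h
      rw [← h n₀, hw₀, hw₀]
  · have key : ∀ s (hs : E.IsSection A id s),
        χ ((fun v => ⟨(E.part v, w v), hw v⟩ : E.V → E'.V) ∘ s) = k := by
      intro s hs
      rw [← hl ⟨s, hs⟩]
      congr 1
      funext i
      refine Subtype.ext (Prod.ext (hs.1 i) (funext fun n => ?_))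
      have hi : E.part (s i) = i := hs.1 i
      cases h : l.idxFun n with
      | none => simp [w, h]
      | some t => simp [w, h, hi]
    rw [key s hs, key s' hs']

/-- One step of the partite construction. -/
theorem exists_amalgam_ramsey (κ : Type*) [Finite κ] [Finite α] [Nonempty Γ] (A : α → α → Γ)
    (e : α ↪ P) (S : PartiteSystem P Γ) : ∃ S' : PartiteSystem P Γ, ∀ χ : (α → S'.V) → κ,
      ∃ h, IsEmb S S' h ∧ ∀ s s', S.IsSection A e s → S.IsSection A e s' →
        χ (h ∘ s) = χ (h ∘ s') := by
  classical
  have := S.finite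
  -- `E` is the subsystem of `S` in the parts hit by `e`.
  let E : PartiteSystem α Γ :=
    { V := {v : S.V // ∃ i, e i = S.part v}
      finite := inferInstance
      part := fun v => v.2.choose
      color := fun u v => S.color u.1 v.1 }
  obtain ⟨E', hE'⟩ := exists_partite_ramsey κ A E
  have := E.finite
  have := E'.finite
  let H : Type := {h : E.V → E'.V // IsEmb E E' h}
  have : Finite H := inferInstanceAs (Finite {h : E.V → E'.V // IsEmb E E' h})
  -- Free amalgamation: over each copy `h` of `E` in `E'` a separate copy of `S` is attached.
  let ext : H → S.V → E'.V ⊕ H × S.V := fun h v =>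
    if hv : ∃ i, e i = S.part v then .inl (h.1 ⟨v, hv⟩) else .inr (h, v)
  have hextinj : ∀ h, Function.Injective (ext h) := by
    intro h u v huv
    by_cases hu : ∃ i, e i = S.part u <;> by_cases hv : ∃ i, e i = S.part v
    · simp only [ext, dif_pos hu, dif_pos hv, Sum.inl.injEq] at huv
      exact congrArg Subtype.val (h.2.1 huv)
    · simp [ext, dif_pos hu, dif_neg hv] at huv
    · simp [ext, dif_neg hu, dif_pos hv] at huv
    · simpa [ext, dif_neg hu, dif_neg hv] using huv
  -- Distinct attached copies meet only inside `E'`, where both inherit their colours from `E'`;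
  -- hence the colouring of `S'` below is well defined.
  have hext : ∀ h h' u u' v v', ext h u = ext h' u' → ext h v = ext h' v' →
      S.color u v = S.color u' v' := by
    have hinl : ∀ h h' u u', (∃ i, e i = S.part u) → ext h u = ext h' u' →
        ∃ i, e i = S.part u' := by
      intro h h' u u' hu huu
      by_contra hu'
      simp [ext, dif_pos hu, dif_neg hu'] at huu
    have hne : ∀ h h' u u', (¬ ∃ i, e i = S.part u) → ext h u = ext h' u' → h = h' := by
      intro h h' u u' hu huu
      by_cases hu' : ∃ i, e i = S.part u'
      · exact absurd (hinl h' h u' u hu' huu.symm) hu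
      · simp only [ext, dif_neg hu, dif_neg hu', Sum.inr.injEq, Prod.mk.injEq] at huu
        exact huu.1
    intro h h' u u' v v' hu hv
    by_cases hpu : ∃ i, e i = S.part u
    · by_cases hpv : ∃ i, e i = S.part v
      · have hpu' := hinl _ _ _ _ hpu hu
        have hpv' := hinl _ _ _ _ hpv hv
        simp only [ext, dif_pos hpu, dif_pos hpu', dif_pos hpv, dif_pos hpv',
          Sum.inl.injEq] at hu hv
        have h₁ := h.2.2.2 ⟨u, hpu⟩ ⟨v, hpv⟩
        rw [hu, hv, h'.2.2.2] at h₁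
        exact h₁.symm
      · obtain rfl := hne _ _ _ _ hpv hv
        rw [hextinj _ hu, hextinj _ hv]
    · obtain rfl := hne _ _ _ _ hpu hu
      rw [hextinj _ hu, hextinj _ hv]
  let S' : PartiteSystem P Γ :=
    { V := E'.V ⊕ H × S.V
      finite := inferInstance
      part := Sum.elim (fun v => e (E'.part v)) fun p => S.part p.2
      color := fun x y => if hxy : ∃ q : H × S.V × S.V, ext q.1 q.2.1 = x ∧ ext q.1 q.2.2 = y then
        S.color hxy.choose.2.1 hxy.choose.2.2 else Classical.arbitrary Γ }
  refine ⟨S', fun χ => ?_⟩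
  obtain ⟨h, hh, hm⟩ := hE' fun s => χ (Sum.inl ∘ s)
  refine ⟨ext ⟨h, hh⟩, ⟨hextinj _, fun v => ?_, fun u v => ?_⟩, fun s s' hs hs' => ?_⟩
  · by_cases hv : ∃ i, e i = S.part v
    · have h₁ : E'.part (h ⟨v, hv⟩) = hv.choose := hh.2.1 ⟨v, hv⟩
      simp only [S', ext, dif_pos hv, Sum.elim_inl, h₁, hv.choose_spec]
    · simp only [S', ext, dif_neg hv, Sum.elim_inr]
  · have hxy : ∃ q : H × S.V × S.V, ext q.1 q.2.1 = ext ⟨h, hh⟩ u ∧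
        ext q.1 q.2.2 = ext ⟨h, hh⟩ v := ⟨(⟨h, hh⟩, u, v), rfl, rfl⟩
    exact (dif_pos hxy).trans (hext _ _ _ _ _ _ hxy.choose_spec.1 hxy.choose_spec.2)
  · have key : ∀ s (hs : S.IsSection A e s), ∃ t, E.IsSection A id t ∧
        ext ⟨h, hh⟩ ∘ s = Sum.inl ∘ (h ∘ t) := by
      intro s hs
      have hp : ∀ i, ∃ j, e j = S.part (s i) := fun i => ⟨i, (hs.1 i).symm⟩
      refine ⟨fun i => ⟨s i, hp i⟩, ⟨fun i => e.injective ?_, hs.2⟩, funext fun i => ?_⟩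
      · exact (hp i).choose_spec.trans (hs.1 i)
      · simp only [ext, Function.comp_apply, dif_pos (hp i)]
    obtain ⟨t, ht, hst⟩ := key s hs
    obtain ⟨t', ht', hst'⟩ := key s' hs'
    rw [hst, hst']
    exact hm t t' ht ht'

/-- The partite construction. -/
theorem exists_ramsey (κ : Type*) [Finite κ] [Finite α] [Nonempty Γ] (A : α → α → Γ)
    (S : PartiteSystem P Γ) (F : Finset (α ↪ P)) : ∃ S' : PartiteSystem P Γ,
      ∀ χ : (α → S'.V) → κ, ∃ h, IsEmb S S' h ∧ ∀ e ∈ F, ∀ s s', S.IsSection A e s →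
        S.IsSection A e s' → χ (h ∘ s) = χ (h ∘ s') := by
  classical
  induction F using Finset.induction_on with
  | empty => exact ⟨S, fun χ => ⟨id, ⟨Function.injective_id, fun _ => rfl, fun _ _ => rfl⟩,
      by simp⟩⟩
  | insert e F _ ih =>
    obtain ⟨S₁, h₁⟩ := ih
    obtain ⟨S₂, h₂⟩ := exists_amalgam_ramsey κ A e S₁
    refine ⟨S₂, fun χ => ?_⟩
    obtain ⟨g, hg, hgm⟩ := h₂ χ
    obtain ⟨h, hh, hhm⟩ := h₁ (fun s => χ (g ∘ s))
    refine ⟨g ∘ h, hg.comp hh, fun e' he' s s' hs hs' => ?_⟩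
    rcases Finset.mem_insert.1 he' with rfl | he'
    · exact hgm _ _ (hs.comp hh) (hs'.comp hh)
    · exact hhm e' he' s s' hs hs'

end PartiteSystem

/-- The Ramsey theorem of Nešetřil and Rödl for finite linearly ordered structures with binary
relations. -/
theorem exists_ordered_ramsey {Γ : Type*} [Nonempty Γ] (κ : Type*) [Finite κ] {a b : ℕ}
    (A : Fin a → Fin a → Γ) (B : Fin b → Fin b → Γ) :
    ∃ (m : ℕ) (C : Fin m → Fin m → Γ), ∀ χ : (Fin a → Fin m) → κ, ∃ f : Fin b → Fin m,
      StrictMono f ∧ (∀ i j, C (f i) (f j) = B i j) ∧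
        ∀ g g' : Fin a → Fin b, StrictMono g → StrictMono g' →
          (∀ i j, B (g i) (g j) = A i j) → (∀ i j, B (g' i) (g' j) = A i j) →
            χ (f ∘ g) = χ (f ∘ g') := by
  classical
  obtain ⟨p, hp⟩ := exists_mono_strictMono (Option κ) a b
  -- A disjoint union of copies of `B`, one for each placement `d` of its vertices into the `p`
  -- parts.
  let S₀ : PartiteSystem (Fin p) Γ :=
    { V := (Fin b → Fin p) × Fin b
      finite := inferInstance
      part := fun v => v.1 v.2
      color := fun u v => if u.1 = v.1 then B u.2 v.2 else Classical.arbitrary Γ }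
  obtain ⟨S, hS⟩ := S₀.exists_ramsey κ A Finset.univ
  have := S.finite
  have := Fintype.ofFinite S.V
  -- Ordering by part first makes every copy with increasing `d` order-preserving; ties are broken
  -- arbitrarily.
  let toLex' : S.V → Fin p ×ₗ Fin (Fintype.card S.V) :=
    fun v => toLex (S.part v, Fintype.equivFin S.V v)
  let _ : LinearOrder S.V := LinearOrder.lift' toLex' fun u v huv => by
    simpa [toLex'] using congrArg (fun x => (ofLex x).2) huv
  have hlt : ∀ u v : S.V, S.part u < S.part v → u < v := fun u v huv =>
    show toLex' u < toLex' v from Prod.Lex.toLex_lt_toLex.2 (Or.inl huv)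
  let o : Fin (Fintype.card S.V) ≃o S.V := Fintype.orderIsoFinOfCardEq S.V rfl
  refine ⟨Fintype.card S.V, fun i j => S.color (o i) (o j), fun χ => ?_⟩
  obtain ⟨h, hh, hm⟩ := hS fun s => χ (o.symm ∘ s)
  -- Inside the image of `h` the colour of a copy of `A` depends only on its parts, so it colours
  -- increasing sequences of parts.
  obtain ⟨d, hd, hdm⟩ := hp fun e => if he : ∃ s, S₀.IsSection A e s then
    some (χ (o.symm ∘ h ∘ he.choose)) else none
  refine ⟨fun i => o.symm (h (d, i)), fun i j hij => o.symm.strictMono (hlt _ _ ?_),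
    fun i j => ?_, fun g g' hg hg' hgA hgA' => ?_⟩
  · rw [hh.2.1, hh.2.1]
    exact hd hij
  · simp [hh.2.2, S₀]
  · have key : ∀ g : Fin a → Fin b, StrictMono g → (∀ i j, B (g i) (g j) = A i j) →
        (if he : ∃ s, S₀.IsSection A (d ∘ g) s then
          some (χ (o.symm ∘ h ∘ he.choose)) else none) =
          some (χ ((fun i => o.symm (h (d, i))) ∘ g)) := by
      intro g hg hgA
      have hs : S₀.IsSection A (d ∘ g) fun i => (d, g i) :=
        ⟨fun _ => rfl, fun i j => by simp [S₀, hgA]⟩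
      have he : ∃ s, S₀.IsSection A (d ∘ g) s := ⟨_, hs⟩
      rw [dif_pos he]
      exact congrArg some (hm ⟨d ∘ g, (hd.comp hg).injective⟩ (Finset.mem_univ _) _ _
        he.choose_spec hs)
    exact Option.some_injective _ ((key g hg hgA).symm.trans ((hdm g g' hg hg').trans
      (key g' hg' hgA')))

/-! ### The embedding Ramsey property -/

namespace Expansion

open FirstOrder

variable {ι : Type} {V : Type u} {W : Type v}

/-- Two families of vertices have the same quantifier-free type. -/
def SameType {α : Type*} (X : Expansion ι V) (φ φ' : α → V) : Prop :=
  (∀ i j, φ i = φ j ↔ φ' i = φ' j) ∧ (∀ i j, X.edge (φ i) (φ j) ↔ X.edge (φ' i) (φ' j)) ∧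
    (∀ i j, X.lt (φ i) (φ j) ↔ X.lt (φ' i) (φ' j)) ∧
      ∀ r i, X.pred r (φ i) ↔ X.pred r (φ' i)

theorem SameType.symm {α : Type*} {X : Expansion ι V} {φ φ' : α → V} (h : X.SameType φ φ') :
    X.SameType φ' φ :=
  ⟨fun i j => (h.1 i j).symm, fun i j => (h.2.1 i j).symm, fun i j => (h.2.2.1 i j).symm,
    fun r i => (h.2.2.2 r i).symm⟩

theorem SameType.trans {α : Type*} {X : Expansion ι V} {φ φ' φ'' : α → V}
    (h : X.SameType φ φ') (h' : X.SameType φ' φ'') : X.SameType φ φ'' :=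
  ⟨fun i j => (h.1 i j).trans (h'.1 i j), fun i j => (h.2.1 i j).trans (h'.2.1 i j),
    fun i j => (h.2.2.1 i j).trans (h'.2.2.1 i j),
    fun r i => (h.2.2.2 r i).trans (h'.2.2.2 r i)⟩

theorem SameType.comp {α β : Type*} {X : Expansion ι V} {φ φ' : α → V} (h : X.SameType φ φ')
    (g : β → α) : X.SameType (φ ∘ g) (φ' ∘ g) :=
  ⟨fun _ _ => h.1 _ _, fun _ _ => h.2.1 _ _, fun _ _ => h.2.2.1 _ _, fun r _ => h.2.2.2 r _⟩

/-- The Ramsey property of the age of `X`, expressed by colourings of families of vertices. -/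
def EmbRamsey.{w} (X : Expansion ι V) : Prop :=
  ∀ (k : ℕ) (α β : Type w) [Finite α] [Finite β] (φ : α → V) (ψ : β → V),
    ∃ C : Set V, C.Finite ∧ ∀ χ : (α → V) → Fin k, ∃ f : β → V, X.SameType ψ f ∧
      (∀ i, f i ∈ C) ∧ ∀ g g' : α → β, X.SameType φ (ψ ∘ g) → X.SameType φ (ψ ∘ g') →
        χ (f ∘ g) = χ (f ∘ g')

/-- Families of the same type as an embedding are embeddings. -/
theorem SameType.exists_embedding (X : Expansion ι V) {α : Type*} [(expLang ι).Structure α] :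
    letI := X.toStructure
    ∀ (e : α ↪[expLang ι] V) (S : (expLang ι).Substructure V) (h : α → V),
      X.SameType e h → (∀ i, h i ∈ S) → ∃ h' : α ↪[expLang ι] S, ∀ i, (h' i : V) = h i := by
  let _ := X.toStructure
  intro e S h hh hS
  refine ⟨⟨⟨fun i => ⟨h i, hS i⟩, fun i j hij => ?_⟩, fun f => isEmptyElim f, fun r x => ?_⟩,
    fun i => rfl⟩
  · exact e.injective ((hh.1 i j).2 (congrArg Subtype.val hij))
  · refine Iff.trans ?_ (e.map_rel r x)
    cases r with
    | edge => exact (hh.2.1 _ _).symm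
    | lt => exact (hh.2.2.1 _ _).symm
    | pred i => exact (hh.2.2.2 _ _).symm

theorem sameType_embedding (X : Expansion ι V) {α : Type*} [(expLang ι).Structure α] :
    letI := X.toStructure
    ∀ e e' : α ↪[expLang ι] V, X.SameType e e' := by
  let _ := X.toStructure
  intro e e'
  refine ⟨fun i j => e.injective.eq_iff.trans e'.injective.eq_iff.symm, fun i j => ?_,
    fun i j => ?_, fun r i => ?_⟩
  · exact (e.map_rel (ExpRel.edge : (expLang ι).Relations 2) ![i, j]).trans
      (e'.map_rel (ExpRel.edge : (expLang ι).Relations 2) ![i, j]).symm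
  · exact (e.map_rel (ExpRel.lt : (expLang ι).Relations 2) ![i, j]).trans
      (e'.map_rel (ExpRel.lt : (expLang ι).Relations 2) ![i, j]).symm
  · exact (e.map_rel (ExpRel.pred r : (expLang ι).Relations 1) ![i]).trans
      (e'.map_rel (ExpRel.pred r : (expLang ι).Relations 1) ![i]).symm

/-- Colour an embedding by the colour of its range. Every copy of `A` inside the range of `f` is the
range of some `f ∘ g`. -/
theorem EmbRamsey.hasRamseyProperty {X : Expansion ι V} (hX : EmbRamsey.{u, u} X) :
    HasRamseyProperty (expLang ι) X.age := by
  classical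
  let _ := X.toStructure
  rintro k A ⟨hA, ⟨eA⟩⟩ B ⟨hB, ⟨eB⟩⟩
  have := Language.Structure.fg_iff_finite.1 hA
  have := Language.Structure.fg_iff_finite.1 hB
  -- The extra colour guarantees a default value for maps that are not embeddings, even if `k = 0`.
  obtain ⟨C₀, hfin, hC⟩ := hX (k + 1) A B eA eB
  let S : (expLang ι).Substructure V := ⟨C₀, fun f => isEmptyElim f⟩
  have : Finite S := hfin
  refine ⟨Bundled.of S, ⟨Language.Structure.fg_iff_finite.2 this, ⟨S.subtype⟩⟩, fun c => ?_⟩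
  let copy : (A ↪[expLang ι] S) → Copies (expLang ι) A S := fun h =>
    ⟨h.toHom.range, ⟨h.equivRange.symm⟩⟩
  obtain ⟨f, hf, hfC, hm⟩ := hC fun h =>
    if hh : ∃ h' : A ↪[expLang ι] S, ∀ i, (h' i : V) = h i then (c (copy hh.choose)).castSucc
    else 0
  obtain ⟨f', hf'⟩ := SameType.exists_embedding X eB S f hf hfC
  refine ⟨f'.toHom.range, ⟨f'.equivRange.symm⟩, ?_⟩
  have key : ∀ A₁ : Copies (expLang ι) A S, A₁.1 ≤ f'.toHom.range →
      ∃ g : A → B, X.SameType eA (eB ∘ g) ∧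
        (if hh : ∃ h' : A ↪[expLang ι] S, ∀ i, (h' i : V) = (f ∘ g) i then
          (c (copy hh.choose)).castSucc else 0) = (c A₁).castSucc := by
    rintro ⟨A₁, ⟨i⟩⟩ hle
    have hex : ∀ a : A, ∃ b : B, f' b = (i.symm a : S) := fun a => hle (i.symm a).2
    choose g hg using hex
    let h₁ : A ↪[expLang ι] S := A₁.subtype.comp i.symm.toEmbedding
    have hfg : ∀ a, (h₁ a : V) = (f ∘ g) a := fun a => by
      rw [Function.comp_apply, ← hf', hg]; rfl
    refine ⟨g, ?_, ?_⟩
    · have h₂ := sameType_embedding X eA (S.subtype.comp h₁)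
      have h₃ : ⇑(S.subtype.comp h₁) = f ∘ g := funext hfg
      rw [h₃] at h₂
      exact h₂.trans (hf.comp g).symm
    · have hh : ∃ h' : A ↪[expLang ι] S, ∀ i, (h' i : V) = (f ∘ g) i := ⟨h₁, hfg⟩
      rw [dif_pos hh]
      congr 2
      have h₂ : hh.choose = h₁ := Language.Embedding.ext fun a =>
        Subtype.ext ((hh.choose_spec a).trans (hfg a).symm)
      rw [h₂]
      refine Subtype.ext (SetLike.ext fun x => ⟨?_, fun hx => ?_⟩)
      · rintro ⟨a, rfl⟩
        exact (i.symm a).2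
      · exact ⟨i ⟨x, hx⟩, congrArg Subtype.val (i.symm_apply_apply ⟨x, hx⟩)⟩
  intro A₁ A₂ h₁ h₂
  obtain ⟨g₁, hg₁, e₁⟩ := key A₁ h₁
  obtain ⟨g₂, hg₂, e₂⟩ := key A₂ h₂
  exact Fin.castSucc_injective _ (e₁.symm.trans ((hm g₁ g₂ hg₁ hg₂).trans e₂))

/-! ### Blow-ups -/

/-- The common generalisation of `blowUp` and `hat`: the edges between vertices whose second
coordinates do not satisfy `t` are reversed. -/
def twist (X : Expansion ι V) (n : ℕ) (t : Fin n → Fin n → Prop) :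
    Expansion (ι ⊕ Fin n) (V × Fin n) :=
  { X.blowUp n with
    edge := fun u v => (t u.2 v.2 ∧ X.edge u.1 v.1) ∨ (¬ t u.2 v.2 ∧ X.edge v.1 u.1) }

theorem blowUp_eq_twist (X : Expansion ι V) (n : ℕ) : X.blowUp n = X.twist n fun _ _ => True := by
  simp [twist, blowUp]

theorem hat_eq_twist (X : Expansion ι V) : X.hat = X.twist 2 (· = ·) := rfl

/-- The predicates `L_i` reveal the second coordinates, hence which edges are reversed, so the edges
of `X` can be recovered. In a tournament two first coordinates are equal iff no edge joins them. -/
theorem sameType_twist {α : Type*} {X : Expansion ι V} (hE : IsTournament X.edge)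
    (hlt : ∀ x, ¬ X.lt x x) (n : ℕ) {t : Fin n → Fin n → Prop} (ht : ∀ i j, t i j → t j i)
    (φ φ' : α → V × Fin n) :
    (X.twist n t).SameType φ φ' ↔
      X.SameType (Prod.fst ∘ φ) (Prod.fst ∘ φ') ∧ ∀ i, (φ i).2 = (φ' i).2 := by
  have hirr : ∀ x, ¬ X.edge x x := fun x h => hE.1 x x h h
  constructor
  · rintro ⟨-, h₂, h₃, h₄⟩
    have hs : ∀ i, (φ i).2 = (φ' i).2 := fun i => ((h₄ (.inr (φ i).2) i).1 rfl).symm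
    have he : ∀ i j, X.edge (φ i).1 (φ j).1 ↔ X.edge (φ' i).1 (φ' j).1 := by
      intro i j
      have h := h₂ i j
      have h' := h₂ j i
      simp only [twist, ← hs] at h h'
      by_cases hij : t (φ i).2 (φ j).2
      · simpa [hij] using h
      · simpa [mt (ht _ _) hij] using h'
    have heq : ∀ i j, (φ i).1 = (φ j).1 ↔ (φ' i).1 = (φ' j).1 := by
      intro i j
      constructor <;> intro h <;> by_contra hne
      · rcases hE.2 _ _ hne with h' | h'
        · exact hirr _ (h ▸ (he i j).2 h')
        · exact hirr _ (h ▸ (he j i).2 h')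
      · rcases hE.2 _ _ hne with h' | h'
        · exact hirr _ (h ▸ (he i j).1 h')
        · exact hirr _ (h ▸ (he j i).1 h')
    refine ⟨⟨heq, he, fun i j => ?_, fun r i => h₄ (.inl r) i⟩, hs⟩
    by_cases hij : (φ i).1 = (φ j).1
    · simp only [Function.comp_apply, hij, (heq i j).1 hij, hlt]
    · have h := h₃ i j
      have hij' := mt (heq i j).2 hij
      simpa [twist, blowUp, hij, hij'] using h
  · rintro ⟨⟨h₁, h₂, h₃, h₄⟩, hs⟩
    simp only [Function.comp_apply] at h₁ h₂ h₃ h₄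
    refine ⟨fun i j => ?_, fun i j => ?_, fun i j => ?_, fun r i => ?_⟩
    · simp [Prod.ext_iff, h₁, hs]
    · simp [twist, h₂, hs]
    · simp [twist, blowUp, h₁, h₃, hs]
    · cases r with
      | inl r => exact h₄ r i
      | inr r => simp [twist, blowUp, hs]

theorem EmbRamsey.twist.{w} {X : Expansion ι V} (hX : EmbRamsey.{u, w} X)
    (hE : IsTournament X.edge) (hlt : ∀ x, ¬ X.lt x x) (n : ℕ) {t : Fin n → Fin n → Prop}
    (ht : ∀ i j, t i j → t j i) : EmbRamsey.{u, w} (X.twist n t) := by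
  intro k α β _ _ φ ψ
  obtain ⟨C, hfin, hC⟩ := hX k α β (Prod.fst ∘ φ) (Prod.fst ∘ ψ)
  refine ⟨C ×ˢ Set.univ, hfin.prod Set.finite_univ, fun χ => ?_⟩
  obtain ⟨f, hf, hfC, hm⟩ := hC fun h => χ fun a => (h a, (φ a).2)
  refine ⟨fun b => (f b, (ψ b).2), (sameType_twist hE hlt n ht _ _).2 ⟨hf, fun _ => rfl⟩,
    fun i => ⟨hfC i, trivial⟩, fun g g' hg hg' => ?_⟩
  rw [sameType_twist hE hlt n ht] at hg hg'
  have key : ∀ g : α → β, (∀ i, (φ i).2 = ((ψ ∘ g) i).2) →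
      (fun b => (f b, (ψ b).2)) ∘ g = fun a => ((f ∘ g) a, (φ a).2) := fun g h =>
    funext fun a => Prod.ext rfl (h a).symm
  rw [key g hg.2, key g' hg'.2]
  exact hm g g' hg.1 hg'.1

/-! ### Criteria for the embedding Ramsey property -/

theorem Iso.sameType_iff {α : Type*} {X : Expansion ι V} {Y : Expansion ι W} (e : V ≃ W)
    (he : (∀ x y, X.edge x y ↔ Y.edge (e x) (e y)) ∧
      (∀ x y, X.lt x y ↔ Y.lt (e x) (e y)) ∧ ∀ i x, X.pred i x ↔ Y.pred i (e x))
    (φ φ' : α → V) : X.SameType φ φ' ↔ Y.SameType (e ∘ φ) (e ∘ φ') := by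
  simp [SameType, he.1, he.2.1, he.2.2]

theorem Iso.embRamsey.{w} {X : Expansion ι V} {Y : Expansion ι W} (h : X.Iso Y)
    (hY : EmbRamsey.{v, w} Y) : EmbRamsey.{u, w} X := by
  obtain ⟨e, he⟩ := h
  intro k α β _ _ φ ψ
  obtain ⟨C, hfin, hC⟩ := hY k α β (e ∘ φ) (e ∘ ψ)
  refine ⟨e.symm '' C, hfin.image _, fun χ => ?_⟩
  obtain ⟨f, hf, hfC, hm⟩ := hC fun h => χ (e.symm ∘ h)
  refine ⟨e.symm ∘ f, ?_, fun i => ⟨f i, hfC i, rfl⟩, fun g g' hg hg' => hm g g' ?_ ?_⟩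
  · rw [Iso.sameType_iff e he]
    simpa [← Function.comp_assoc] using hf
  · exact (Iso.sameType_iff e he _ _).1 hg
  · exact (Iso.sameType_iff e he _ _).1 hg'

theorem Iso.isTournament {X : Expansion ι V} {Y : Expansion ι W} (h : X.Iso Y)
    (hY : IsTournament Y.edge) : IsTournament X.edge := by
  obtain ⟨e, he, -⟩ := h
  refine ⟨fun x y h => ?_, fun x y h => ?_⟩
  · rw [he] at h ⊢
    exact hY.1 _ _ h
  · rw [he, he]
    exact hY.2 _ _ (e.injective.ne h)

theorem Iso.lt_irrefl {X : Expansion ι V} {Y : Expansion ι W} (h : X.Iso Y)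
    (hY : ∀ x, ¬ Y.lt x x) (x : V) : ¬ X.lt x x := by
  obtain ⟨e, -, he, -⟩ := h
  rw [he]
  exact hY _

/-- If the predicates separate the vertices, there is at most one copy of every structure. -/
theorem EmbRamsey.of_pred_separates.{w} {X : Expansion ι V}
    (hX : ∀ x y, (∀ i, X.pred i x ↔ X.pred i y) → x = y) : EmbRamsey.{u, w} X := by
  intro k α β _ _ φ ψ
  refine ⟨Set.range ψ, Set.finite_range ψ, fun χ => ⟨ψ, ?_, fun i => ⟨i, rfl⟩, ?_⟩⟩
  · exact ⟨fun _ _ => Iff.rfl, fun _ _ => Iff.rfl, fun _ _ => Iff.rfl, fun _ _ => Iff.rfl⟩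
  · intro g g' hg hg'
    congr 1
    funext i
    exact hX _ _ fun r => (hg.2.2.2 r i).symm.trans (hg'.2.2.2 r i)

/-- A finite family in a linear order factors through an increasing sequence. -/
theorem exists_strictMono_factor {α : Type*} [Finite α] [LinearOrder V] (φ : α → V) :
    ∃ (a : ℕ) (φ₀ : Fin a → V) (q : α → Fin a), StrictMono φ₀ ∧ Function.Surjective q ∧
      φ = φ₀ ∘ q := by
  classical
  have := Fintype.ofFinite α
  let s := Finset.univ.image φ
  let o := s.orderIsoOfFin rfl
  have hφ : ∀ i, φ i ∈ s := fun i => Finset.mem_image_of_mem _ (Finset.mem_univ i)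
  refine ⟨s.card, fun i => (o i : V), fun i => o.symm ⟨φ i, hφ i⟩, fun i j hij =>
    o.strictMono hij, fun i => ?_, funext fun i => by simp⟩
  obtain ⟨j, -, hj⟩ := Finset.mem_image.1 (o i).2
  exact ⟨j, by rw [OrderIso.symm_apply_eq]; exact Subtype.ext hj⟩

/-- The criterion derived from the theorem of Nešetřil and Rödl: `X` is a linearly ordered
tournament, in which the isomorphism types of points and of increasing pairs are coded by `c₁` and
`c₂`, and all combinations of codes are realised in `X`. -/
theorem EmbRamsey.of_code.{w} [LinearOrder V] {X : Expansion ι V} {Γ Δ : Type} [Nonempty Γ]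
    [Nonempty Δ]     (hE : IsTournament X.edge) (hlt : ∀ x y, X.lt x y ↔ x < y) (c₁ : V → Δ) (c₂ : V → V → Γ)
    (h₁ : ∀ x y, c₁ x = c₁ y ↔ ∀ i, X.pred i x ↔ X.pred i y)
    (h₂ : ∀ x y x' y', x < y → x' < y' → c₁ x = c₁ x' → c₁ y = c₁ y' →
      (c₂ x y = c₂ x' y' ↔ (X.edge x y ↔ X.edge x' y')))
    (hreal : ∀ (m : ℕ) (d₁ : Fin m → Δ) (d₂ : Fin m → Fin m → Γ), ∃ e : Fin m → V,
      StrictMono e ∧ (∀ i, c₁ (e i) = d₁ i) ∧ ∀ i j, i < j → c₂ (e i) (e j) = d₂ i j) :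
    EmbRamsey.{u, w} X := by
  classical
  have hirr : ∀ x, ¬ X.edge x x := fun x h => hE.1 x x h h
  have hflip : ∀ x y, x < y → (X.edge y x ↔ ¬ X.edge x y) := fun x y hxy =>
    ⟨fun h => hE.1 _ _ h, fun h => (hE.2 x y hxy.ne).resolve_left h⟩
  have hsame : ∀ {α : Type w} (φ φ' : α → V), X.SameType φ φ' ↔
      (∀ i j, φ i < φ j ↔ φ' i < φ' j) ∧ (∀ i, c₁ (φ i) = c₁ (φ' i)) ∧
        ∀ i j, φ i < φ j → c₂ (φ i) (φ j) = c₂ (φ' i) (φ' j) := by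
    intro α φ φ'
    constructor
    · rintro ⟨-, he, hl, hp⟩
      simp only [hlt] at hl
      have hc : ∀ i, c₁ (φ i) = c₁ (φ' i) := fun i => (h₁ _ _).2 fun r => hp r i
      exact ⟨hl, hc, fun i j hij =>
        (h₂ _ _ _ _ hij ((hl i j).1 hij) (hc i) (hc j)).2 (he i j)⟩
    · rintro ⟨hl, hc, hd⟩
      have he : ∀ i j, φ i < φ j → (X.edge (φ i) (φ j) ↔ X.edge (φ' i) (φ' j)) :=
        fun i j hij => (h₂ _ _ _ _ hij ((hl i j).1 hij) (hc i) (hc j)).1 (hd i j hij)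
      have heq : ∀ i j, φ i = φ j ↔ φ' i = φ' j := fun i j => by
        rw [eq_iff_le_not_lt, eq_iff_le_not_lt, ← not_lt, ← not_lt, hl i j, hl j i]
      refine ⟨heq, fun i j => ?_, fun i j => by rw [hlt, hlt, hl], fun r i => (h₁ _ _).1 (hc i) r⟩
      rcases lt_trichotomy (φ i) (φ j) with h | h | h
      · exact he i j h
      · rw [← h, ← (heq i j).1 h]
        exact iff_of_false (hirr _) (hirr _)
      · rw [hflip _ _ h, hflip _ _ ((hl j i).1 h), he j i h]
  intro k α β _ _ φ ψ
  obtain ⟨a, φ₀, q, hφ₀, hq, rfl⟩ := exists_strictMono_factor φ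
  obtain ⟨b, ψ₀, r, hψ₀, hr, rfl⟩ := exists_strictMono_factor ψ
  -- Point codes and pair codes form one binary colouring; the constant default off the increasing
  -- pairs is respected by increasing maps.
  let code : ∀ {m : ℕ}, (Fin m → V) → Fin m → Fin m → Δ × Γ := fun e i j =>
    (c₁ (e i), if i < j then c₂ (e i) (e j) else Classical.arbitrary Γ)
  obtain ⟨m, C, hC⟩ := exists_ordered_ramsey (Fin k) (code φ₀) (code ψ₀)
  obtain ⟨e, he, he₁, he₂⟩ := hreal m (fun i => (C i i).1) fun i j => (C i j).2
  refine ⟨Set.range e, Set.finite_range e, fun χ => ?_⟩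
  obtain ⟨f, hf, hfB, hm⟩ := hC fun s => χ (e ∘ s ∘ q)
  refine ⟨e ∘ f ∘ r, (hsame _ _).2 ⟨fun i j => ?_, fun i => ?_, fun i j hij => ?_⟩,
    fun i => ⟨_, rfl⟩, fun g g' hg hg' => ?_⟩
  · exact hψ₀.lt_iff_lt.trans (he.comp hf).lt_iff_lt.symm
  · simp only [Function.comp_apply, he₁, hfB, code]
  · have hr := hψ₀.lt_iff_lt.1 hij
    simp only [Function.comp_apply, he₂ _ _ (hf hr), hfB, code, if_pos hr]
  · have key : ∀ g : α → β, X.SameType (φ₀ ∘ q) ((ψ₀ ∘ r) ∘ g) → ∃ g₀ : Fin a → Fin b,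
        StrictMono g₀ ∧ (∀ i j, code ψ₀ (g₀ i) (g₀ j) = code φ₀ i j) ∧ r ∘ g = g₀ ∘ q := by
      intro g hg
      obtain ⟨hl, hc, hd⟩ := (hsame _ _).1 hg
      have hmono : ∀ i j, q i < q j ↔ r (g i) < r (g j) := fun i j =>
        hφ₀.lt_iff_lt.symm.trans ((hl i j).trans hψ₀.lt_iff_lt)
      -- Since `q` and `r ∘ g` order the indices in the same way, `r ∘ g` descends along `q` to an
      -- increasing map.
      obtain ⟨q', hq'⟩ := hq.hasRightInverse
      have hg₀ : StrictMono fun i => r (g (q' i)) := fun i j hij =>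
        (hmono _ _).1 (by rwa [hq', hq'])
      refine ⟨fun i => r (g (q' i)), hg₀, fun i j => ?_, funext fun i => ?_⟩
      · have h := hc (q' i)
        have h' := hd (q' i) (q' j)
        simp only [Function.comp_apply, hq' i, hq' j, hφ₀.lt_iff_lt] at h h'
        simp only [code, hg₀.lt_iff_lt, h]
        by_cases hij : i < j
        · simp only [if_pos hij, h' hij]
        · simp only [if_neg hij]
      · have h := hmono i (q' (q i))
        have h' := hmono (q' (q i)) i
        rw [hq', lt_self_iff_false, false_iff, not_lt] at h h'
        exact le_antisymm h' h
    obtain ⟨g₀, hg₀, hgc, hgq⟩ := key g hg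
    obtain ⟨g₀', hg₀', hgc', hgq'⟩ := key g' hg'
    have := hm g₀ g₀' hg₀ hg₀' hgc hgc'
    simpa only [Function.comp_assoc, hgq, hgq'] using this

end Expansion

/-! ### The homogeneous tournaments -/

open FirstOrder Expansion

theorem isTournament_lt {V : Type*} [LinearOrder V] : IsTournament fun x y : V => x < y :=
  ⟨fun _ _ => lt_asymm, fun _ _ => lt_or_gt_of_ne⟩

theorem isTournament_pointStar : IsTournament pointStar.edge :=
  ⟨fun _ _ h _ => h, fun x y h => absurd (Subsingleton.elim x y) h⟩

theorem isTournament_cycleStar (lt : Fin 3 → Fin 3 → Prop) :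
    IsTournament (cycleStar lt).edge := by
  change IsTournament fun x y : Fin 3 => y = x + 1
  constructor <;> decide

theorem embRamsey_ratStar.{w} : EmbRamsey.{0, w} ratStar :=
  EmbRamsey.of_code (Γ := Unit) (Δ := Unit) isTournament_lt (fun _ _ => Iff.rfl) (fun _ => ())
    (fun _ _ => ()) (fun _ _ => ⟨fun _ i => i.elim0, fun _ => rfl⟩)
    (fun _ _ _ _ h h' _ _ => ⟨fun _ => iff_of_true h h', fun _ => rfl⟩)
    fun _ _ _ => ⟨fun i => ((i : ℕ) : ℚ), fun _ _ h => Nat.cast_lt.2 h, fun _ => rfl,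
      fun _ _ _ => rfl⟩

/-! ### The dense local order -/

namespace RatCircle

/-- The slope of the line through the origin and a point of the circle. -/
noncomputable def slope (x : RatCircle) : ℝ := (x.1 : ℂ).im / (x.1 : ℂ).re

/-- Irrationality of `π`, used to keep rational angles off the vertical axis and to exclude
antipodal pairs. -/
theorem rat_mul_pi_eq {q : ℚ} {n : ℤ} (m : ℤ) (h : (n : ℝ) * Real.pi = m * q) :
    n = 0 := by
  by_contra hn
  have hn' : (n : ℝ) ≠ 0 := Int.cast_ne_zero.2 hn
  refine irrational_pi ⟨m * q / n, ?_⟩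
  push_cast
  rw [div_eq_iff hn', ← h, mul_comm]

theorem re_ne_zero (x : RatCircle) : (x.1 : ℂ).re ≠ 0 := by
  obtain ⟨_, q, rfl⟩ := x
  simp only [Circle.coe_exp, Complex.exp_ofReal_mul_I_re]
  intro h
  obtain ⟨n, hn⟩ := Real.cos_eq_zero_iff.1 h
  have := rat_mul_pi_eq (q := q) (n := 2 * n + 1) 2 (by push_cast; linarith)
  omega

/-- The right side is the imaginary part of `y / x`, the sine of its argument, which on `(-π, π]` is
positive exactly on `(0, π)`. -/
theorem edge_iff_im (x y : RatCircle) : x.edge y ↔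
    0 < (y.1 : ℂ).im * (x.1 : ℂ).re - (y.1 : ℂ).re * (x.1 : ℂ).im := by
  have h₁ : ((y.1 / x.1 : Circle) : ℂ).im =
      (y.1 : ℂ).im * (x.1 : ℂ).re - (y.1 : ℂ).re * (x.1 : ℂ).im := by
    rw [div_eq_mul_inv, Circle.coe_mul, Circle.coe_inv_eq_conj]
    simp only [Complex.mul_im, Complex.conj_re, Complex.conj_im]
    ring
  have h₂ : ‖((y.1 / x.1 : Circle) : ℂ)‖ = 1 := Circle.norm_coe _
  rw [← h₁, ← div_one ((y.1 / x.1 : Circle) : ℂ).im, ← h₂, ← Complex.sin_arg]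
  constructor
  · rintro ⟨h, h'⟩
    exact Real.sin_pos_of_pos_of_lt_pi h h'
  · intro h
    refine ⟨?_, lt_of_le_of_ne (Complex.arg_le_pi _) fun h' => by
      rw [h', Real.sin_pi] at h
      exact h.false⟩
    by_contra h'
    exact h.not_ge (Real.sin_nonpos_of_nonpos_of_neg_pi_le (not_lt.1 h')
      (Complex.neg_pi_lt_arg _).le)

theorem edge_iff (x y : RatCircle) : x.edge y ↔
    0 < (x.1 : ℂ).re * (y.1 : ℂ).re * (y.slope - x.slope) := by
  have hx := x.re_ne_zero
  have hy := y.re_ne_zero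
  rw [edge_iff_im, slope, slope]
  refine iff_of_eq (congrArg _ ?_)
  field_simp

theorem re_mul_re_pos_iff (x y : RatCircle) :
    0 < (x.1 : ℂ).re * (y.1 : ℂ).re ↔ (x.isLeft ↔ y.isLeft) := by
  have hx := x.re_ne_zero
  have hy := y.re_ne_zero
  rw [isLeft, isLeft]
  rcases hx.lt_or_gt with hx | hx <;> rcases hy.lt_or_gt with hy | hy
  · exact iff_of_true (mul_pos_of_neg_of_neg hx hy) (iff_of_true hx hy)
  · exact iff_of_false (mul_neg_of_neg_of_pos hx hy).not_gt fun h => hy.not_gt (h.1 hx)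
  · exact iff_of_false (mul_neg_of_pos_of_neg hx hy).not_gt fun h => hx.not_gt (h.2 hy)
  · exact iff_of_true (mul_pos hx hy) (iff_of_false hx.not_gt hy.not_gt)

theorem edge_iff_of_iff {x y : RatCircle} (h : x.isLeft ↔ y.isLeft) :
    x.edge y ↔ x.slope < y.slope := by
  rw [edge_iff, mul_pos_iff_of_pos_left ((re_mul_re_pos_iff x y).2 h), sub_pos]

theorem edge_iff_of_not_iff {x y : RatCircle} (h : ¬ (x.isLeft ↔ y.isLeft)) :
    x.edge y ↔ y.slope < x.slope := by
  have h' : (x.1 : ℂ).re * (y.1 : ℂ).re < 0 :=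
    lt_of_le_of_ne (not_lt.1 (mt (re_mul_re_pos_iff x y).1 h))
      (mul_ne_zero x.re_ne_zero y.re_ne_zero)
  rw [edge_iff, ← neg_mul_neg, mul_pos_iff_of_pos_left (neg_pos.2 h'), neg_sub, sub_pos]

/-- Reflecting the left half through the origin keeps slopes and reverses exactly the edges between
the halves. -/
theorem localOrderStar_lt_iff (x y : RatCircle) : localOrderStar.lt x y ↔ x.slope < y.slope := by
  change ((x.isLeft ↔ y.isLeft) ∧ x.edge y) ∨ (¬ (x.isLeft ↔ y.isLeft) ∧ y.edge x) ↔ _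
  by_cases h : x.isLeft ↔ y.isLeft
  · simp [h, edge_iff_of_iff h]
  · simp only [h, false_and, not_false_iff, true_and, false_or]
    exact edge_iff_of_not_iff fun h' => h h'.symm

theorem slope_exp (q : ℚ) : slope ⟨Circle.exp (q : ℝ), q, rfl⟩ = Real.tan q := by
  simp only [slope, Circle.coe_exp, Complex.exp_ofReal_mul_I_re, Complex.exp_ofReal_mul_I_im,
    Real.tan_eq_sin_div_cos]

theorem slope_injective : Function.Injective slope := by
  intro x y h
  have hx := x.re_ne_zero
  have hy := y.re_ne_zero
  obtain ⟨_, q, rfl⟩ := x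
  obtain ⟨_, r, rfl⟩ := y
  have hs : Real.sin ((r - q : ℚ) : ℝ) = 0 := by
    change _ / _ = _ / _ at h
    rw [div_eq_div_iff hx hy] at h
    simp only [Circle.coe_exp, Complex.exp_ofReal_mul_I_re, Complex.exp_ofReal_mul_I_im] at h
    push_cast
    rw [Real.sin_sub]
    linarith
  obtain ⟨n, hn⟩ := Real.sin_eq_zero_iff.1 hs
  have h0 := rat_mul_pi_eq (q := r - q) (n := n) 1 (by rw [hn]; simp)
  rw [h0, Int.cast_zero, zero_mul, eq_comm, Rat.cast_eq_zero, sub_eq_zero] at hn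
  subst hn
  rfl

theorem isTournament_edge : IsTournament edge := by
  refine ⟨fun x y h h' => ?_, fun x y h => ?_⟩
  · by_cases hl : x.isLeft ↔ y.isLeft
    · exact lt_asymm ((edge_iff_of_iff hl).1 h) ((edge_iff_of_iff hl.symm).1 h')
    · exact lt_asymm ((edge_iff_of_not_iff hl).1 h)
        ((edge_iff_of_not_iff fun h => hl h.symm).1 h')
  · have hs := slope_injective.ne h
    by_cases hl : x.isLeft ↔ y.isLeft
    · rw [edge_iff_of_iff hl, edge_iff_of_iff hl.symm]
      exact hs.lt_or_gt
    · rw [edge_iff_of_not_iff hl, edge_iff_of_not_iff fun h => hl h.symm]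
      exact hs.lt_or_gt.symm

/-- In every open interval of positive slopes below `tan 1` there are points in both halves. -/
theorem exists_slope {s t : ℝ} (hs : 0 ≤ s) (hst : s < t) (ht : t ≤ 1) (b : Prop) :
    ∃ x : RatCircle, (x.isLeft ↔ b) ∧ Real.tan s < x.slope ∧ x.slope < Real.tan t := by
  classical
  have hpi := Real.pi_gt_three
  have htan : ∀ r : ℝ, s < r → r < t → Real.tan s < Real.tan r ∧ Real.tan r < Real.tan t :=
    fun r h h' => ⟨Real.tan_lt_tan_of_lt_of_lt_pi_div_two (by linarith) (by linarith) h,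
      Real.tan_lt_tan_of_lt_of_lt_pi_div_two (by linarith) (by linarith) h'⟩
  have hcos : ∀ r : ℝ, s < r → r < t → 0 < Real.cos r := fun r h h' =>
    Real.cos_pos_of_mem_Ioo ⟨by linarith, by linarith⟩
  by_cases hb : b
  · obtain ⟨q, hq, hq'⟩ := exists_rat_btwn (add_lt_add_left hst Real.pi)
    refine ⟨⟨Circle.exp (q : ℝ), q, rfl⟩, ?_, ?_⟩
    · simp only [isLeft, Circle.coe_exp, Complex.exp_ofReal_mul_I_re, hb, iff_true]
      have := hcos (q - Real.pi) (by linarith) (by linarith)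
      rw [Real.cos_sub_pi] at this
      exact neg_pos.1 this
    · rw [slope_exp, ← Real.tan_sub_pi (q : ℝ)]
      exact htan _ (by linarith) (by linarith)
  · obtain ⟨q, hq, hq'⟩ := exists_rat_btwn hst
    refine ⟨⟨Circle.exp (q : ℝ), q, rfl⟩, ?_, ?_⟩
    · simp only [isLeft, Circle.coe_exp, Complex.exp_ofReal_mul_I_re, hb, iff_false, not_lt]
      exact (hcos q hq hq').le
    · rw [slope_exp]
      exact htan _ hq hq'

/-- The halves and the order of slopes determine the edges, so the half is the only code needed. -/
theorem embRamsey_localOrderStar.{w} : EmbRamsey.{0, w} localOrderStar := by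
  classical
  let _ : LinearOrder RatCircle := LinearOrder.lift' slope slope_injective
  refine EmbRamsey.of_code (Γ := Unit) (Δ := Prop) isTournament_edge localOrderStar_lt_iff isLeft
    (fun _ _ => ()) (fun x y => ?_) (fun x y x' y' h h' hx hy => ?_) fun m d _ => ?_
  · refine ⟨fun h i => ?_, fun h => propext (h 0)⟩
    simp only [localOrderStar, h]
  · refine ⟨fun _ => ?_, fun _ => rfl⟩
    change x.slope < y.slope at h
    change x'.slope < y'.slope at h'
    change x.edge y ↔ x'.edge y'
    by_cases hl : x.isLeft ↔ y.isLeft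
    · rw [edge_iff_of_iff hl, edge_iff_of_iff (by rwa [← hx, ← hy])]
      exact iff_of_true h h'
    · rw [edge_iff_of_not_iff hl, edge_iff_of_not_iff (by rwa [← hx, ← hy])]
      exact iff_of_false h.not_gt h'.not_gt
  -- The `i`-th point takes its slope from the tangents of the `i`-th of `m` equal subintervals of
  -- `[0, 1]`, where `tan` is increasing as `1 < π / 2`.
  · have hex : ∀ i : Fin m, ∃ x : RatCircle, (x.isLeft ↔ d i) ∧
        Real.tan ((i : ℕ) / m) < x.slope ∧ x.slope < Real.tan (((i : ℕ) + 1) / m) := by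
      intro i
      have hm : (0 : ℝ) < m := by exact_mod_cast i.pos
      refine exists_slope (by positivity) (by gcongr; linarith) ?_ _
      rw [div_le_one hm]
      exact_mod_cast i.2
    choose e he he₁ he₂ using hex
    refine ⟨e, fun i j hij => ?_, fun i => propext (he i), fun _ _ _ => rfl⟩
    refine (he₂ i).trans_le (le_trans ?_ (he₁ j).le)
    have hm : (0 : ℝ) < m := by exact_mod_cast i.pos
    have hpi := Real.pi_gt_three
    have hle : ((i : ℕ) + 1 : ℝ) / m ≤ (j : ℕ) / m := by
      gcongr
      exact_mod_cast hij
    have hj : ((j : ℕ) : ℝ) / m ≤ 1 := by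
      rw [div_le_one hm]
      exact_mod_cast j.2.le
    have hi : 0 ≤ ((i : ℕ) + 1 : ℝ) / m := by positivity
    exact Real.strictMonoOn_tan.monotoneOn ⟨by linarith, by linarith⟩
      ⟨by linarith, by linarith⟩ hle

end RatCircle

/-! ### The generic tournament -/

namespace Expansion

variable {V : Type u} {X : Expansion (Fin 0) V}

/-- Finite substructures of the generic structure are linearly ordered tournaments. -/
theorem IsGenericStar.restrict (hX : IsGenericStar X) (s : Set V) (hs : s.Finite) :
    IsTournament (fun x y : s => X.edge x y) ∧ IsStrictTotalOrder s fun x y : s => X.lt x y := by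
  obtain ⟨_, h⟩ := hX
  let _ := X.toStructure
  let S : (expLang (Fin 0)).Substructure V := ⟨s, fun f => isEmptyElim f⟩
  have : Finite S := hs
  have hS : (⟨S, inferInstance⟩ : Bundled (expLang (Fin 0)).Structure) ∈ (expLang (Fin 0)).age V :=
    ⟨Language.Structure.fg_iff_finite.2 this, ⟨S.subtype⟩⟩
  rw [h.age] at hS
  exact hS.2

/-- The axioms concern two points at a time, so they can be checked in finite substructures. -/
theorem IsGenericStar.isTournament (hX : IsGenericStar X) : IsTournament X.edge := by
  have h := fun x y : V => (hX.restrict {x, y} (Set.toFinite _)).1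
  exact ⟨fun x y => (h x y).1 ⟨x, by simp⟩ ⟨y, by simp⟩,
    fun x y hxy => (h x y).2 ⟨x, by simp⟩ ⟨y, by simp⟩ (by simpa using hxy)⟩

theorem IsGenericStar.isStrictTotalOrder (hX : IsGenericStar X) :
    IsStrictTotalOrder V X.lt := by
  have h := fun x y z : V => (hX.restrict {x, y, z} (Set.toFinite _)).2
  refine { trichotomous := fun x y hxy hyx => ?_, irrefl := fun x => ?_, trans := fun x y z => ?_ }
  · exact congrArg Subtype.val ((h x y y).trichotomous ⟨x, by simp⟩ ⟨y, by simp⟩ hxy hyx)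
  · exact (h x x x).irrefl ⟨x, by simp⟩
  · exact (h x y z).trans ⟨x, by simp⟩ ⟨y, by simp⟩ ⟨z, by simp⟩

theorem IsGenericStar.embRamsey.{w} (hX : IsGenericStar X) : EmbRamsey.{u, w} X := by
  classical
  have := hX.isStrictTotalOrder
  let _ : LinearOrder V := linearOrderOfSTO X.lt
  refine EmbRamsey.of_code (Γ := Prop) (Δ := Unit) hX.isTournament (fun _ _ => Iff.rfl)
    (fun _ => ()) X.edge (fun _ _ => ⟨fun _ i => i.elim0, fun _ => rfl⟩)
    (fun _ _ _ _ _ _ _ _ => eq_iff_iff) fun m _ d => ?_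
  -- Any prescription `d` of edge directions on increasing pairs is a finite ordered tournament,
  -- hence lies in the age.
  let Y : Expansion (Fin 0) (ULift.{u} (Fin m)) :=
    { edge := fun x y => (x.down < y.down ∧ d x.down y.down) ∨
        (y.down < x.down ∧ ¬ d y.down x.down)
      lt := fun x y => x.down < y.down
      pred := fun i _ => i.elim0 }
  have hY : (⟨ULift.{u} (Fin m), Y.toStructure⟩ : Bundled (expLang (Fin 0)).Structure) ∈
      orderedTournaments := by
    refine ⟨inferInstanceAs (Finite (ULift.{u} (Fin m))), ⟨fun x y => ?_, fun x y hxy => ?_⟩, ?_⟩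
    · change Y.edge x y → ¬ Y.edge y x
      rintro (⟨h, h'⟩ | ⟨h, h'⟩) (⟨g, g'⟩ | ⟨g, g'⟩)
      · exact lt_asymm h g
      · exact g' h'
      · exact h' g'
      · exact lt_asymm h g
    · change Y.edge x y ∨ Y.edge y x
      rcases lt_or_gt_of_ne (ULift.down_injective.ne hxy) with h | h
      · by_cases h' : d x.down y.down
        · exact Or.inl (Or.inl ⟨h, h'⟩)
        · exact Or.inr (Or.inr ⟨h, h'⟩)
      · by_cases h' : d y.down x.down
        · exact Or.inr (Or.inl ⟨h, h'⟩)
        · exact Or.inl (Or.inr ⟨h, h'⟩)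
    · change IsStrictTotalOrder (ULift.{u} (Fin m)) Y.lt
      exact inferInstanceAs (IsStrictTotalOrder (ULift.{u} (Fin m)) (· < ·))
  obtain ⟨_, h⟩ := hX
  let _ := X.toStructure
  let _ := Y.toStructure
  rw [← h.age] at hY
  obtain ⟨-, ⟨e⟩⟩ := hY
  have hlt : ∀ i j : Fin m, e ⟨i⟩ < e ⟨j⟩ ↔ i < j := fun i j =>
    e.map_rel (ExpRel.lt : (expLang (Fin 0)).Relations 2) ![⟨i⟩, ⟨j⟩]
  have hedge : ∀ i j : Fin m, X.edge (e ⟨i⟩) (e ⟨j⟩) ↔ Y.edge ⟨i⟩ ⟨j⟩ := fun i j =>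
    e.map_rel (ExpRel.edge : (expLang (Fin 0)).Relations 2) ![⟨i⟩, ⟨j⟩]
  refine ⟨fun i => e ⟨i⟩, fun i j => (hlt i j).2, fun _ => rfl, fun i j hij => propext ?_⟩
  rw [hedge]
  simp [Y, hij, hij.not_gt]

end Expansion

/-! ### The main theorem -/

theorem HomTournament.IsStar.embRamsey.{w} {T : HomTournament} {V : Type u}
    {X : Expansion T.Pred V} (hX : T.IsStar X) : EmbRamsey.{u, w} X := by
  cases T with
  | point => exact Iso.embRamsey hX (.of_pred_separates fun x y _ => Subsingleton.elim x y)
  | cycle =>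
    obtain ⟨lt, -, hX⟩ := hX
    exact hX.embRamsey (.of_pred_separates fun x y h => ((h x).1 rfl).symm)
  | rat => exact Iso.embRamsey hX embRamsey_ratStar
  | localOrder => exact Iso.embRamsey hX RatCircle.embRamsey_localOrderStar
  | generic => exact IsGenericStar.embRamsey hX

theorem HomTournament.IsStar.isTournament {T : HomTournament} {V : Type u}
    {X : Expansion T.Pred V} (hX : T.IsStar X) : IsTournament X.edge := by
  cases T with
  | point => exact Iso.isTournament hX isTournament_pointStar
  | cycle =>
    obtain ⟨lt, -, hX⟩ := hX
    exact hX.isTournament (isTournament_cycleStar lt)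
  | rat => exact Iso.isTournament hX isTournament_lt
  | localOrder => exact Iso.isTournament hX RatCircle.isTournament_edge
  | generic => exact IsGenericStar.isTournament hX

theorem HomTournament.IsStar.lt_irrefl {T : HomTournament} {V : Type u}
    {X : Expansion T.Pred V} (hX : T.IsStar X) (x : V) : ¬ X.lt x x := by
  cases T with
  | point => exact Iso.lt_irrefl hX (fun _ h => h) x
  | cycle =>
    obtain ⟨lt, hlt, hX⟩ := hX
    exact hX.lt_irrefl hlt.irrefl x
  | rat => exact Iso.lt_irrefl hX (fun y => _root_.lt_irrefl (y : ℚ)) x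
  | localOrder =>
    refine Iso.lt_irrefl hX (fun y h => ?_) x
    exact ((RatCircle.localOrderStar_lt_iff y y).1 h).false
  | generic => exact (IsGenericStar.isStrictTotalOrder hX).irrefl x

theorem mainTheorem9 (T : HomTournament) {V : Type u} (Tstar : Expansion T.Pred V)
    (hT : T.IsStar Tstar) :
    (∀ n : ℕ, 0 < n →
      HasRamseyProperty (expLang (T.Pred ⊕ Fin n)) (Tstar.blowUp n).age) ∧
    HasRamseyProperty (expLang (T.Pred ⊕ Fin 2)) Tstar.hat.age := by
  refine ⟨fun n _ => ?_, ?_⟩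
  · rw [blowUp_eq_twist]
    exact (hT.embRamsey.twist hT.isTournament hT.lt_irrefl n fun _ _ => id).hasRamseyProperty
  · rw [hat_eq_twist]
    exact (hT.embRamsey.twist hT.isTournament hT.lt_irrefl 2 fun _ _ => Eq.symm).hasRamseyProperty
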